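/- Let $\Gamma$ be a group endowed with a metric $\mathrm{dist}$ that is left invariant, i.e. $\mathrm{dist}(gx,gy)=\mathrm{dist}(x,y)$ for all $g,x,y\in\Gamma$, and all of whose balls are finite. For a non-principal ultrafilter $\omega$ on $\mathbb{N}$, a scaling sequence $d=(d_n)$ of positive real numbers with $d_n\to\infty$, and a sequence $e=(e_n)$ of points of $\Gamma$, the asymptotic cone $\mathrm{Con}_\omega(\Gamma;e,d)$ is the metric space obtained from the set of all sequences $(x_n)$ in $\Gamma$ for which $\left(\mathrm{dist}(x_n,e_n)/d_n\right)_n$ is bounded, with $\mathrm{dist}_\omega\left((x_n),(y_n)\right)=\lim_\omega \mathrm{dist}(x_n,y_n)/d_n$, by identifying sequences at $\mathrm{dist}_\omega$-distance $0$. 1. If for all $\omega$, $d$ and $e$ as above the asymptotic cone $\mathrm{Con}_\omega(\Gamma;e,d)$ is path-connected, then $\Gamma$ is finitely generated. 2. If for all $\omega$, $d$ and $e$ as above the asymptotic cone $\mathrm{Con}_\omega(\Gamma;e,d)$ is simply connected (that is, path-connected with trivial fundamental group), then $\Gamma$ is finitely presented. -/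

import Mathlib

open Filter Topology

/-- A scaling sequence: a sequence of positive real numbers diverging to infinity. -/
structure ScalingSequence where
  /-- The underlying sequence of real numbers. -/
  toFun : ℕ → ℝ
  pos : ∀ n, 0 < toFun n
  tendsto_atTop : Tendsto toFun atTop atTop

/-- The sequences `x` in `X` for which `dist (x n) (e n) / d n` is bounded. The ultrafilter is a
parameter only so that the pseudometric `dist_ω` can be an instance on this type. -/
structure ConeSequence {X : Type*} [MetricSpace X] (ω : Ultrafilter ℕ) (d : ScalingSequence)
    (e : ℕ → X) where
  /-- The underlying sequence of points. -/
  toFun : ℕ → X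
  bounded : ∃ C : ℝ, ∀ n, dist (toFun n) (e n) / d.toFun n ≤ C

namespace ConeSequence

variable {X : Type*} [MetricSpace X] {ω : Ultrafilter ℕ} {d : ScalingSequence} {e : ℕ → X}

/-- `dist_ω (x, y) = lim_ω dist (x n, y n) / d n`. -/
noncomputable instance instDist : Dist (ConeSequence ω d e) where
  dist x y := limUnder (ω : Filter ℕ) fun n => dist (x.toFun n) (y.toFun n) / d.toFun n

/-- The limit defining `dist_ω` exists. -/
theorem tendsto_dist (x y : ConeSequence ω d e) :
    Tendsto (fun n => dist (x.toFun n) (y.toFun n) / d.toFun n) ω (𝓝 (dist x y)) := by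
  obtain ⟨A, hA⟩ := x.bounded
  obtain ⟨B, hB⟩ := y.bounded
  have h : ∀ n, dist (x.toFun n) (y.toFun n) / d.toFun n ∈ Set.Icc 0 (A + B) := fun n => by
    refine ⟨div_nonneg dist_nonneg (d.pos n).le, ?_⟩
    refine le_trans ?_ (add_le_add (hA n) (hB n))
    rw [← add_div]
    exact div_le_div_of_nonneg_right (dist_triangle_right _ _ _) (d.pos n).le
  obtain ⟨a, -, ha⟩ := isCompact_Icc.ultrafilter_le_nhds
    (ω.map fun n => dist (x.toFun n) (y.toFun n) / d.toFun n)
    (le_principal_iff.2 (Filter.mem_map.2 (Filter.univ_mem' h)))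
  exact tendsto_nhds_limUnder ⟨a, ha⟩

noncomputable instance instPseudoMetricSpace : PseudoMetricSpace (ConeSequence ω d e) where
  dist_self x := tendsto_nhds_unique (tendsto_dist x x) (by simp)
  dist_comm x y := tendsto_nhds_unique (tendsto_dist x y) (by
    simpa only [dist_comm] using tendsto_dist y x)
  dist_triangle x y z := le_of_tendsto_of_tendsto' (tendsto_dist x z)
    ((tendsto_dist x y).add (tendsto_dist y z)) fun n => by
      rw [← add_div]
      exact div_le_div_of_nonneg_right (dist_triangle _ _ _) (d.pos n).le

end ConeSequence

/-- The asymptotic cone `Con_ω (X; e, d)`: the metric space obtained from `ConeSequence ω d e` by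
identifying `x` and `y` when `dist_ω (x, y) = 0`. -/
abbrev AsymptoticCone {X : Type*} [MetricSpace X] (ω : Ultrafilter ℕ) (d : ScalingSequence)
    (e : ℕ → X) : Type _ :=
  SeparationQuotient (ConeSequence ω d e)

/-! Both parts are compactness arguments: a uniform statement about large scales in `Γ` that fails
along a sequence of scales contradicts a property of the cone rescaled by that sequence.

For part 1, paths in cones give a uniform `K` such that, at every large scale `r`, an element of the
`r`-ball is reached from `1` in `K` steps of length at most `r / 2`
(`exists_hasChains_of_pathConnected`). Iterating the halving down to scale `R` shows that the
`R`-ball, which is finite, generates `Γ`.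

For part 2, consider maps into a group that are multiplicative on the `r`-ball. Multiplying their
values along a chain gives a holonomy, which is invariant under discrete homotopies with mesh at
most `r`. If short-step loops with a bounded number of steps had nontrivial holonomy at arbitrarily
large scales, they would yield a loop in a cone; it is null-homotopic, and homotopy invariance of
holonomy (`HasHolonomy.of_homotopic`) gives a contradiction. Joining consecutive points of the limit
loop by small paths uses the chains of part 1 at all scales (`HasChains.exists_path`).

Trivial holonomy makes the product along a chain independent of the chain, so a local homomorphism
extends from scale `r` to `2 * r`, keeping its values on a proportionally smaller ball
(`exists_hasExtensions`). Repeated doubling produces a global homomorphism. Applied to the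
tautological map into the group presented by the multiplication table of a large ball, it exhibits
`Γ` as a retract of a finitely presented group. -/

section LocalHom

/-! ### Local homomorphisms and products along chains. -/

variable {Γ H : Type*} [Group Γ] [Group H]

/-- The product of the values of `φ` on the increments of the chain `w 0, …, w n`. -/
def chainProd (φ : Γ → H) (w : ℕ → Γ) : ℕ → H
  | 0 => 1
  | n + 1 => chainProd φ w n * φ ((w n)⁻¹ * w (n + 1))

theorem chainProd_congr {φ : Γ → H} {v w : ℕ → Γ} {n : ℕ} (h : ∀ i ≤ n, v i = w i) :
    chainProd φ v n = chainProd φ w n := by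
  induction n with
  | zero => rfl
  | succ n ih =>
    rw [chainProd, chainProd, ih fun i hi => h i (hi.trans n.le_succ), h n n.le_succ, h _ le_rfl]

theorem chainProd_add (φ : Γ → H) (w : ℕ → Γ) (m n : ℕ) :
    chainProd φ w (m + n) = chainProd φ w m * chainProd φ (fun i => w (m + i)) n := by
  induction n with
  | zero => simp [chainProd]
  | succ n ih => rw [← add_assoc, chainProd, chainProd, ih, mul_assoc, add_assoc]

theorem chainProd_mul_left (φ : Γ → H) (g : Γ) (w : ℕ → Γ) (n : ℕ) :
    chainProd φ (fun i => g * w i) n = chainProd φ w n := by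
  induction n with
  | zero => rfl
  | succ n ih => rw [chainProd, chainProd, ih]; congr 2; group

variable [MetricSpace Γ]

/-- A map from `Γ` to a group is a local homomorphism at scale `r` if it is multiplicative on
those products whose factors and value all lie in the ball of radius `r` around `1`. -/
def IsMulHomOnBall (r : ℝ) (φ : Γ → H) : Prop :=
  ∀ a b, dist 1 a ≤ r → dist 1 b ≤ r → dist 1 (a * b) ≤ r → φ (a * b) = φ a * φ b

variable (hinv : ∀ g x y : Γ, dist (g * x) (g * y) = dist x y)

include hinv

theorem dist_one_inv_mul (x y : Γ) : dist 1 (x⁻¹ * y) = dist x y := by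
  rw [← hinv x, mul_one, mul_inv_cancel_left]

namespace IsMulHomOnBall

variable {r : ℝ} {φ : Γ → H} (hφ : IsMulHomOnBall r φ)

include hφ

theorem map_triangle {x y z : Γ} (hxy : dist x y ≤ r) (hyz : dist y z ≤ r) (hxz : dist x z ≤ r) :
    φ (x⁻¹ * y) * φ (y⁻¹ * z) = φ (x⁻¹ * z) := by
  have e : x⁻¹ * y * (y⁻¹ * z) = x⁻¹ * z := by group
  rw [← hφ, e] <;> simpa only [dist_one_inv_mul hinv, e]

omit hinv in
theorem map_one (hr : 0 ≤ r) : φ 1 = 1 := by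
  have := hφ 1 1 (by simpa) (by simpa) (by simpa)
  simpa using this

theorem map_inv_mul_mul_map (hr : 0 ≤ r) {x y : Γ} (hxy : dist x y ≤ r) :
    φ (x⁻¹ * y) * φ (y⁻¹ * x) = 1 := by
  rw [hφ.map_triangle hinv hxy (by rwa [dist_comm]) (by simpa), inv_mul_cancel, hφ.map_one hr]

theorem chainProd_eq (hr : 0 ≤ r) {w : ℕ → Γ} {n : ℕ}
    (hw : ∀ i ≤ n, ∀ j ≤ n, dist (w i) (w j) ≤ r) :
    chainProd φ w n = φ ((w 0)⁻¹ * w n) := by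
  induction n with
  | zero => simp [chainProd, hφ.map_one hr]
  | succ n ih =>
    rw [chainProd, ih fun i hi j hj => hw i (by lia) j (by lia), hφ.map_triangle hinv] <;>
      exact hw _ (by lia) _ (by lia)

/-- The diagonals from `v i` to `w (i + 1)` cut the ladder between the chains into small triangles,
and `φ` respects each triangle. -/
theorem chainProd_strip {v w : ℕ → Γ} {n : ℕ} (hv : ∀ i < n, dist (v i) (v (i + 1)) ≤ r)
    (hw : ∀ i < n, dist (w i) (w (i + 1)) ≤ r) (hvw : ∀ i ≤ n, dist (v i) (w i) ≤ r)
    (hd : ∀ i < n, dist (v i) (w (i + 1)) ≤ r) :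
    chainProd φ v n * φ ((v n)⁻¹ * w n) = φ ((v 0)⁻¹ * w 0) * chainProd φ w n := by
  induction n with
  | zero => simp [chainProd]
  | succ n ih =>
    rw [chainProd, mul_assoc, hφ.map_triangle hinv (hv n n.lt_succ_self) (hvw _ le_rfl)
      (hd n n.lt_succ_self), chainProd, ← mul_assoc, ← ih (fun i hi => hv i (by lia))
      (fun i hi => hw i (by lia)) (fun i hi => hvw i (by lia)) (fun i hi => hd i (by lia)),
      mul_assoc, hφ.map_triangle hinv (hvw n n.le_succ) (hw n n.lt_succ_self)
      (hd n n.lt_succ_self)]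

/-- Stacked strips form a discrete homotopy: the two boundary routes across the grid have the same
product. -/
theorem chainProd_grid {w : ℕ → ℕ → Γ} {m n : ℕ}
    (h : ∀ i ≤ m, ∀ j < n, dist (w i j) (w i (j + 1)) ≤ r)
    (v : ∀ i < m, ∀ j ≤ n, dist (w i j) (w (i + 1) j) ≤ r)
    (d : ∀ i < m, ∀ j < n, dist (w i j) (w (i + 1) (j + 1)) ≤ r) :
    chainProd φ (w 0) n * chainProd φ (fun i => w i n) m =
      chainProd φ (fun i => w i 0) m * chainProd φ (w m) n := by
  induction m with
  | zero => simp [chainProd]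
  | succ m ih =>
    rw [chainProd, ← mul_assoc, ih (fun i hi => h i (by lia)) (fun i hi => v i (by lia))
      (fun i hi => d i (by lia)), mul_assoc, hφ.chainProd_strip hinv (h m m.le_succ)
      (h (m + 1) le_rfl) (v m m.lt_succ_self) (d m m.lt_succ_self), chainProd, mul_assoc]

theorem chainProd_mul_reverse (hr : 0 ≤ r) {w : ℕ → Γ} {n : ℕ}
    (hw : ∀ i < n, dist (w i) (w (i + 1)) ≤ r) :
    chainProd φ w n * chainProd φ (fun i => w (n - i)) n = 1 := by
  induction n with
  | zero => simp [chainProd]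
  | succ n ih =>
    rw [add_comm n 1, chainProd_add φ (fun i => w (1 + n - i)) 1 n, add_comm 1 n, chainProd]
    simp only [chainProd, one_mul, Nat.add_sub_cancel_left, Nat.sub_zero,
      zero_add, add_comm n 1, Nat.add_sub_add_left]
    rw [add_comm 1 n, mul_assoc, ← mul_assoc (φ _) (φ _),
      hφ.map_inv_mul_mul_map hinv hr (hw n n.lt_succ_self), one_mul]
    exact ih fun i hi => hw i (by lia)

end IsMulHomOnBall

end LocalHom

/-! ### From distances in the cone to distances in the space. -/

namespace ConeSequence

variable {X : Type*} [MetricSpace X] {ω : Ultrafilter ℕ} {d : ScalingSequence} {e : ℕ → X}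

theorem eventually_dist_lt {x y : ConeSequence ω d e} {c : ℝ} (h : dist x y < c) :
    ∀ᶠ n in (ω : Filter ℕ), dist (x.toFun n) (y.toFun n) < c * d.toFun n := by
  filter_upwards [(tendsto_dist x y).eventually_lt_const h] with n hn
  rwa [div_lt_iff₀ (d.pos n)] at hn

theorem dist_le_of_eventually {x y : ConeSequence ω d e} {c : ℝ}
    (h : ∀ᶠ n in (ω : Filter ℕ), dist (x.toFun n) (y.toFun n) ≤ c * d.toFun n) :
    dist x y ≤ c := by
  refine le_of_tendsto (tendsto_dist x y) ?_
  filter_upwards [h] with n hn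
  rwa [div_le_iff₀ (d.pos n)]

theorem eventually_dist_le {x y : ConeSequence ω d e} (h : dist x y < 1) :
    ∀ᶠ n in (ω : Filter ℕ), dist (x.toFun n) (y.toFun n) ≤ d.toFun n := by
  filter_upwards [eventually_dist_lt h] with n hn
  simpa using hn.le

theorem eventually_dist_le_of_mk_eq {x y : ConeSequence ω d e}
    (h : SeparationQuotient.mk x = SeparationQuotient.mk y) :
    ∀ᶠ n in (ω : Filter ℕ), dist (x.toFun n) (y.toFun n) ≤ d.toFun n := by
  refine eventually_dist_le ?_
  rw [← SeparationQuotient.dist_mk, h, dist_self]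
  exact one_pos

end ConeSequence

theorem Path.exists_forall_dist_lt {C : Type*} [PseudoMetricSpace C] {X Y : C} (p : Path X Y)
    {ε : ℝ} (hε : 0 < ε) :
    ∃ δ > 0, ∀ s t : ℝ, |s - t| < δ → dist (p.extend s) (p.extend t) < ε := by
  obtain ⟨δ, hδ, h⟩ := Metric.uniformContinuous_iff.1
    (CompactSpace.uniformContinuous_of_continuous p.continuous) ε hε
  refine ⟨δ, hδ, fun s t hst => h (lt_of_le_of_lt ?_ hst)⟩
  exact Set.abs_projIcc_sub_projIcc zero_le_one

/-! ### Chains from path-connected cones. -/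

section Chains

variable {Γ : Type*} [Group Γ] [MetricSpace Γ]

/-- Elements in the ball of radius `r` are joined to `1` by chains of `K` steps of size `r / 2`,
as soon as `r ≥ R`. -/
def HasChains (Γ : Type*) [Group Γ] [MetricSpace Γ] (K : ℕ) (R : ℝ) : Prop :=
  ∀ r ≥ R, ∀ g : Γ, dist 1 g ≤ r →
    ∃ x : ℕ → Γ, x 0 = 1 ∧ (∀ i ≥ K, x i = g) ∧ ∀ i, dist (x i) (x (i + 1)) ≤ r / 2

/-- If no `K` and `R` work, the bad elements, rescaled by their bad scales, define a point of a
cone. A path to it, finely subdivided, gives chains with a fixed number of steps for `ω`-almost all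
indices. -/
theorem exists_hasChains_of_pathConnected
    (hpc : ∀ ω : Ultrafilter ℕ, (ω : Filter ℕ) ≤ cofinite →
      ∀ (d : ScalingSequence) (e : ℕ → Γ), PathConnectedSpace (AsymptoticCone ω d e)) :
    ∃ K : ℕ, 0 < K ∧ ∃ R : ℝ, 0 < R ∧ HasChains Γ K R := by
  simp only [HasChains]
  by_contra! h
  -- Taking both `K` and `R` to be `n + 1` makes the scales diverge and eventually rules out chains
  -- of any fixed length.
  choose r hr g hg hx using fun n : ℕ => h (n + 1) n.succ_pos (n + 1) (by positivity)
  let d : ScalingSequence := ⟨r, fun n => lt_of_lt_of_le (by positivity) (hr n),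
    tendsto_atTop_mono (fun n => (le_add_of_nonneg_right zero_le_one).trans (hr n))
      tendsto_natCast_atTop_atTop⟩
  let ω : Ultrafilter ℕ := hyperfilter ℕ
  let e : ℕ → Γ := fun _ => 1
  have := hpc ω hyperfilter_le_cofinite d e
  let E : ConeSequence ω d e := ⟨e, 0, fun n => by simp⟩
  let G : ConeSequence ω d e := ⟨g, 1, fun n => by
    rw [div_le_one (d.pos n), dist_comm]; exact hg n⟩
  let p := PathConnectedSpace.somePath (SeparationQuotient.mk E) (SeparationQuotient.mk G)
  obtain ⟨δ, hδ, hp⟩ := p.exists_forall_dist_lt (ε := 1 / 2) (by norm_num)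
  obtain ⟨N, hN⟩ := exists_nat_one_div_lt hδ
  choose l hl using SeparationQuotient.surjective_mk (X := ConeSequence ω d e)
  -- The endpoints are lifted to `E` and `G` themselves, so that each chain starts at `1` and ends
  -- at `g n` exactly.
  let w : ℕ → ConeSequence ω d e := fun i =>
    if i = 0 then E else if N + 1 ≤ i then G else l (p.extend (i / ((N : ℝ) + 1)))
  have hw : ∀ i, SeparationQuotient.mk (w i) = p.extend (i / ((N : ℝ) + 1)) := fun i => by
    simp only [w]
    split_ifs with h0 h1
    · simp [h0]
    · refine (p.extend_of_one_le ?_).symm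
      rw [one_le_div (by positivity)]
      exact_mod_cast h1
    · exact hl _
  have hstep : ∀ᶠ n in (ω : Filter ℕ), ∀ i ∈ Set.Iio (N + 1),
      dist ((w i).toFun n) ((w (i + 1)).toFun n) < 1 / 2 * r n := by
    rw [eventually_all_finite (Set.finite_Iio _)]
    intro i _
    refine ConeSequence.eventually_dist_lt ?_
    rw [← SeparationQuotient.dist_mk, hw, hw]
    refine hp _ _ ?_
    rwa [← sub_div, abs_div, abs_of_pos (a := (N : ℝ) + 1) (by positivity),
      show ((i : ℝ) - ((i + 1 : ℕ) : ℝ)) = -1 by push_cast; ring, abs_neg, abs_one]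
  have hlarge : ∀ᶠ n in (ω : Filter ℕ), N ≤ n :=
    Nat.hyperfilter_le_atTop (eventually_ge_atTop N)
  obtain ⟨n, hn, hNn⟩ := (hstep.and hlarge).exists
  have hwG : ∀ i ≥ N + 1, w i = G := fun i hi => by simp only [w]; grind
  obtain ⟨i, hi⟩ := hx n (fun i => (w i).toFun n) (by simp [w, E, e])
    (fun i hi => by rw [hwG i (by lia)])
  rcases lt_or_ge i (N + 1) with h1 | h1
  · linarith [hn i h1]
  · rw [hwG i h1, hwG (i + 1) (by lia), dist_self] at hi
    linarith [d.pos n, show d.toFun n = r n from rfl]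

variable (hinv : ∀ g x y : Γ, dist (g * x) (g * y) = dist x y)

variable {K : ℕ} {R : ℝ} (hK : HasChains Γ K R)
include hinv hK

theorem HasChains.closure_eq_top (hR : 0 < R) : Subgroup.closure {g : Γ | dist 1 g ≤ R} = ⊤ := by
  have key : ∀ (m : ℕ) (g : Γ), dist 1 g ≤ 2 ^ m * R →
      g ∈ Subgroup.closure {g : Γ | dist 1 g ≤ R} := by
    intro m
    induction m with
    | zero => exact fun g hg => Subgroup.subset_closure (by simpa using hg)
    | succ m ih =>
      intro g hg
      obtain ⟨x, x0, xK, hx⟩ := hK _ (le_mul_of_one_le_left hR.le (one_le_pow₀ (by norm_num))) g hg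
      have : ∀ i, x i ∈ Subgroup.closure {g : Γ | dist 1 g ≤ R} := fun i => by
        induction i with
        | zero => rw [x0]; exact one_mem _
        | succ i hi =>
          rw [← mul_inv_cancel_left (x i) (x (i + 1))]
          refine mul_mem hi (ih _ ?_)
          rw [dist_one_inv_mul hinv]
          refine (hx i).trans (le_of_eq ?_)
          ring
      rw [← xK K le_rfl]
      exact this K
  rw [eq_top_iff]
  intro g _
  obtain ⟨m, hm⟩ := pow_unbounded_of_one_lt (dist 1 g / R) (one_lt_two (α := ℝ))
  exact key m g ((div_lt_iff₀ hR).1 hm).le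

/-- Each halving of the step length replaces one step by `K` steps; `i / K` indexes the coarse step
and `i % K` the position within it. -/
theorem HasChains.exists_pow_chain (hK0 : 0 < K) (hR : 0 < R) (m : ℕ) :
    ∀ r ≥ R, ∀ g : Γ, dist 1 g ≤ 2 ^ m * r →
      ∃ x : ℕ → Γ, x 0 = 1 ∧ (∀ i ≥ K ^ m, x i = g) ∧ ∀ i, dist (x i) (x (i + 1)) ≤ r := by
  induction m with
  | zero =>
    intro r hr g hg
    refine ⟨fun i => if i = 0 then 1 else g, by simp, fun i hi => by grind, fun i => ?_⟩
    have : 0 ≤ r := hR.le.trans hr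
    by_cases h : i = 0 <;> simp_all
  | succ m ih =>
    intro r hr g hg
    have hr2 : 2 * r ≥ R := by linarith
    obtain ⟨y, y0, yg, hy⟩ := ih (2 * r) hr2 g (by rw [← mul_assoc, ← pow_succ]; exact hg)
    choose z z0 zK hz using fun i =>
      hK (2 * r) hr2 ((y i)⁻¹ * y (i + 1)) ((dist_one_inv_mul hinv _ _).trans_le (hy i))
    suffices hv : ∀ i, dist (y (i / K) * z (i / K) (i % K))
        (y ((i + 1) / K) * z ((i + 1) / K) ((i + 1) % K)) ≤ r by
      -- The index is frozen at `K ^ (m + 1)`: past the end, the chain `z` chosen for a trivial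
      -- increment need not be constant.
      refine ⟨fun i => y (min i (K ^ (m + 1)) / K) * z (min i (K ^ (m + 1)) / K)
        (min i (K ^ (m + 1)) % K), by simp [y0, z0], fun i hi => ?_, fun i => ?_⟩
      · simp only [min_eq_right hi]
        rw [pow_succ, Nat.mul_div_cancel _ hK0, Nat.mul_mod_left, z0, mul_one,
          yg _ le_rfl]
      · rcases lt_or_ge i (K ^ (m + 1)) with h | h
        · simpa only [min_eq_left h.le, min_eq_left (Nat.succ_le_of_lt h)] using hv i
        · simp only [min_eq_right h, min_eq_right (h.trans i.le_succ), dist_self]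
          linarith
    intro i
    rcases lt_or_ge (i % K + 1) K with h | h
    · have h1 : (i + 1) / K = i / K := by
        rw [Nat.div_eq_iff hK0]
        have := Nat.div_add_mod i K
        have := mul_comm K (i / K)
        constructor <;> lia
      have h2 : (i + 1) % K = i % K + 1 := by
        have := Nat.div_add_mod i K
        have := Nat.div_add_mod (i + 1) K
        rw [h1] at this
        lia
      simp only [h1, h2, hinv]
      linarith [hz (i / K) (i % K)]
    · have hlt := Nat.mod_lt i hK0
      have h0 : i + 1 = K * (i / K + 1) := by
        have := Nat.div_add_mod i K
        rw [mul_add]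
        lia
      have h1 : (i + 1) / K = i / K + 1 := by rw [h0, Nat.mul_div_cancel_left _ hK0]
      have h2 : (i + 1) % K = 0 := by rw [h0, Nat.mul_mod_right]
      simp only [h1, h2, z0]
      have : y (i / K + 1) = y (i / K) * z (i / K) (i % K + 1) := by
        rw [zK _ _ h, mul_inv_cancel_left]
      rw [mul_one, this, hinv]
      linarith [hz (i / K) (i % K)]

end Chains

/-! ### Coarse paths and small paths in the cone. -/

section CoarsePaths

variable {Γ : Type*} [Group Γ] [MetricSpace Γ]
  (hinv : ∀ g x y : Γ, dist (g * x) (g * y) = dist x y)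
  {K : ℕ} {R : ℝ} (hK : HasChains Γ K R)

theorem dist_le_of_dist_succ_le {X : Type*} [PseudoMetricSpace X] {x : ℕ → X} {c : ℝ}
    (hx : ∀ i, dist (x i) (x (i + 1)) ≤ c) {i j : ℕ} (hij : i ≤ j) :
    dist (x i) (x j) ≤ (j - i) * c := by
  induction j, hij using Nat.le_induction with
  | base => simp
  | succ j _ ih =>
    push_cast
    linarith [dist_triangle (x i) (x j) (x (j + 1)), hx j]

include hinv hK

/-- Self-similar construction: on each interval of length `1 / K` run a coarse path for one step of
the chain, at half the scale. Time shrinks by `K` while distance shrinks by `2`, giving a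
Hölder-type modulus; the `+ 1` absorbs jumps at the bottom scale `R`. The separate estimates at the
endpoints keep constants from growing with `m`: an interval straddling a breakpoint is split there,
and the doubling from `2 * K` to `4 * K` happens only once. -/
theorem HasChains.exists_coarse_path_aux (hK0 : 0 < K) (hR : 0 < R) (m : ℕ) :
    ∀ g : Γ, dist 1 g ≤ 2 ^ m * R → ∃ f : ℝ → Γ, f 0 = 1 ∧ f 1 = g ∧
      (∀ (j : ℕ) (t : ℝ), 0 ≤ t → t ≤ 1 → K ^ j * t < 1 →
        dist 1 (f t) ≤ 2 * K * (2 ^ m / 2 ^ j + 1) * R) ∧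
      (∀ (j : ℕ) (t : ℝ), 0 ≤ t → t ≤ 1 → K ^ j * (1 - t) < 1 →
        dist (f t) g ≤ 2 * K * (2 ^ m / 2 ^ j + 1) * R) ∧
      (∀ (j : ℕ) (s t : ℝ), 0 ≤ s → s ≤ t → t ≤ 1 → K ^ j * (t - s) < 1 →
        dist (f s) (f t) ≤ 4 * K * (2 ^ m / 2 ^ j + 1) * R) := by
  have hK1 : (1 : ℝ) ≤ K := by exact_mod_cast hK0
  have hKR : R ≤ K * R := le_mul_of_one_le_left hR.le hK1
  have hpos : ∀ m j : ℕ, 0 ≤ (K : ℝ) * (2 ^ m / 2 ^ j) * R := fun m j => by positivity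
  induction m with
  | zero =>
    intro g hg
    have key : ∀ s t : ℝ, dist (if s < 1 then 1 else g) (if t < 1 then 1 else g) ≤ R := by
      intro s t
      have hg' : dist 1 g ≤ R := by simpa using hg
      split_ifs <;> simp [hR.le, hg', dist_comm g 1]
    have h2 : ∀ j : ℕ, R ≤ 2 * K * (2 ^ 0 / 2 ^ j + 1) * R := fun j => by
      linarith [hpos 0 j]
    refine ⟨fun t => if t < 1 then 1 else g, by simp, by simp, fun j t _ _ _ => ?_,
      fun j t _ _ _ => ?_, fun j s t _ _ _ _ => ?_⟩
    · simpa using (key 0 t).trans (h2 j)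
    · simpa using (key t 1).trans (h2 j)
    · exact (key s t).trans (by linarith [hpos 0 j, h2 j])
  | succ m ih =>
    intro g hg
    obtain ⟨x, x0, xK, hx⟩ := hK _ (le_mul_of_one_le_left hR.le (one_le_pow₀ (by norm_num))) g hg
    have hx' : ∀ i, dist (x i) (x (i + 1)) ≤ 2 ^ m * R := fun i =>
      (hx i).trans_eq (by ring)
    choose F F0 F1 hFa hFb hFc using fun i =>
      ih ((x i)⁻¹ * x (i + 1)) ((dist_one_inv_mul hinv _ _).trans_le (hx' i))
    have hpow : ∀ j : ℕ, (2 : ℝ) ^ (m + 1) / 2 ^ (j + 1) = 2 ^ m / 2 ^ j := fun j => by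
      rw [pow_succ, pow_succ, mul_div_mul_right _ _ two_ne_zero]
    have hlt : ∀ {j : ℕ} {u : ℝ}, 0 ≤ u → (K : ℝ) ^ (j + 1) * u < 1 →
        (K : ℝ) ^ j * (K * u) < 1 ∧ K * u < 1 := fun {j u} hu h => by
      rw [pow_succ, mul_assoc] at h
      exact ⟨h, lt_of_le_of_lt (le_mul_of_one_le_left (by positivity) (one_le_pow₀ hK1)) h⟩
    let f : ℝ → Γ := fun t => x ⌊K * t⌋₊ * F ⌊K * t⌋₊ (K * t - ⌊K * t⌋₊)
    have hfl : ∀ {t : ℝ}, 0 ≤ t → (⌊K * t⌋₊ : ℝ) ≤ K * t := fun ht =>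
      Nat.floor_le (by positivity)
    have hflK : ∀ {t : ℝ}, t ≤ 1 → ⌊K * t⌋₊ ≤ K := fun ht =>
      Nat.floor_le_of_le (mul_le_of_le_one_right (by positivity) ht)
    have hfl1 : ∀ t : ℝ, K * t < ⌊K * t⌋₊ + 1 := fun t => Nat.lt_floor_add_one _
    have hf1 : f 1 = g := by simp [f, F0, xK K le_rfl]
    have hf : ∀ (i : ℕ) (t : ℝ), i ≤ K * t → K * t < i + 1 → f t = x i * F i (K * t - i) := by
      intro i t h1 h2
      have : ⌊K * t⌋₊ = i := by rw [Nat.floor_eq_iff (i.cast_nonneg.trans h1)]; exact ⟨h1, h2⟩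
      simp only [f, this]
    have hstart : ∀ (t : ℝ), 0 ≤ t →
        dist (x ⌊K * t⌋₊) (f t) ≤ 2 * K * (2 ^ m / 2 ^ 0 + 1) * R := fun t ht => by
      conv_lhs => rw [← mul_one (x ⌊K * t⌋₊)]
      rw [hinv]
      have := hfl ht
      have := hfl1 t
      exact hFa _ 0 _ (by linarith) (by linarith) (by linarith)
    have ha : ∀ (j : ℕ) (t : ℝ), 0 ≤ t → t ≤ 1 → K ^ j * t < 1 →
        dist 1 (f t) ≤ 2 * K * (2 ^ (m + 1) / 2 ^ j + 1) * R := by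
      intro j t ht0 ht1 hj
      cases j with
      | zero =>
        have h1 := dist_le_of_dist_succ_le hx' (Nat.zero_le ⌊K * t⌋₊)
        have h2 : (⌊K * t⌋₊ : ℝ) * (2 ^ m * R) ≤ K * (2 ^ m * R) := by
          gcongr
          exact hflK ht1
        have h3 := hstart t ht0
        rw [x0] at h1
        rw [pow_zero, div_one] at h3 ⊢
        have h4 := hpos m 0
        rw [pow_zero, div_one] at h4
        rw [pow_succ]
        push_cast at h1
        linarith [dist_triangle 1 (x ⌊K * t⌋₊) (f t)]
      | succ j =>
        obtain ⟨h1, h2⟩ := hlt ht0 hj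
        have h3 : (0 : ℝ) ≤ K * t := by positivity
        rw [hpow, hf 0 t (by simpa) (by simpa), x0, one_mul, Nat.cast_zero, sub_zero]
        exact hFa 0 j _ h3 h2.le h1
    have hb : ∀ (j : ℕ) (t : ℝ), 0 ≤ t → t ≤ 1 → K ^ j * (1 - t) < 1 →
        dist (f t) g ≤ 2 * K * (2 ^ (m + 1) / 2 ^ j + 1) * R := by
      intro j t ht0 ht1 hj
      cases j with
      | zero =>
        have h1 := dist_le_of_dist_succ_le hx' (hflK ht1)
        have h2 : ((K : ℝ) - ⌊K * t⌋₊) * (2 ^ m * R) ≤ K * (2 ^ m * R) := by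
          gcongr
          simp
        have h3 := hstart t ht0
        rw [xK K le_rfl] at h1
        rw [pow_zero, div_one] at h3 ⊢
        have h4 := hpos m 0
        rw [pow_zero, div_one] at h4
        rw [pow_succ]
        linarith [dist_triangle_left (f t) g (x ⌊K * t⌋₊)]
      | succ j =>
        -- At `t = 1` the floor is `K`, beyond the last piece, which has index `K - 1`.
        rcases ht1.eq_or_lt with rfl | ht1
        · rw [hf1, dist_self]
          positivity
        obtain ⟨h1, h2⟩ := hlt (sub_nonneg.2 ht1.le) hj
        have h3 : (K : ℝ) * t < K := mul_lt_of_lt_one_right (by positivity) ht1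
        obtain ⟨k, rfl⟩ : ∃ k, K = k + 1 := ⟨K - 1, by lia⟩
        push_cast at *
        rw [hpow, hf k t (by linarith) (by linarith), ← xK (k + 1) le_rfl,
          ← mul_inv_cancel_left (x k) (x (k + 1)), hinv]
        refine hFb k j _ (by linarith) (by linarith) (lt_of_eq_of_lt ?_ h1)
        congr 1
        ring
    refine ⟨f, by simp [f, x0, F0], hf1, ha, hb, fun j s t hs hst ht hj => ?_⟩
    cases j with
    | zero =>
      rcases ht.eq_or_lt with rfl | ht1
      · rw [hf1]
        have := hb 0 s hs hst hj
        have : 0 ≤ 2 * K * (2 ^ (m + 1) / 2 ^ 0 + 1) * R := by positivity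
        linarith
      · have h1 := ha 0 s hs (hst.trans ht) (by linarith)
        have h2 := ha 0 t (hs.trans hst) ht (by linarith)
        linarith [dist_triangle_left (f s) (f t) 1]
    | succ j =>
      obtain ⟨h1, h2⟩ := hlt (sub_nonneg.2 hst) hj
      rw [hpow]
      have hKst : (K : ℝ) * s ≤ K * t := by gcongr
      have hs1 := hfl hs
      have hs2 := hfl1 s
      have ht1 := hfl (hs.trans hst)
      have ht2 := hfl1 t
      have hle : ⌊K * s⌋₊ ≤ ⌊K * t⌋₊ := Nat.floor_mono hKst
      have hle2 : ⌊K * t⌋₊ ≤ ⌊K * s⌋₊ + 1 := by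
        have : (⌊K * t⌋₊ : ℝ) < ⌊K * s⌋₊ + 2 := by linarith
        have : ⌊K * t⌋₊ < ⌊K * s⌋₊ + 2 := by exact_mod_cast this
        lia
      rcases hle.eq_or_lt with h | h
      · rw [← h] at ht1 ht2
        rw [hf _ s hs1 hs2, hf _ t ht1 ht2, hinv]
        refine hFc _ j _ _ (by linarith) (by linarith) (by linarith) (lt_of_eq_of_lt ?_ h1)
        ring
      · have h : ⌊K * t⌋₊ = ⌊K * s⌋₊ + 1 := by lia
        rw [h] at ht1 ht2
        push_cast at ht1 ht2
        rw [hf _ s hs1 hs2, hf (⌊K * s⌋₊ + 1) t (by push_cast; linarith) (by push_cast; linarith)]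
        set i := ⌊K * s⌋₊
        have hj0 : (0 : ℝ) ≤ K ^ j := by positivity
        have e1 : dist (x i * F i (K * s - i)) (x (i + 1)) ≤ 2 * K * (2 ^ m / 2 ^ j + 1) * R := by
          rw [← mul_inv_cancel_left (x i) (x (i + 1)), hinv]
          refine hFb i j _ (by linarith) (by linarith) (lt_of_le_of_lt ?_ h1)
          gcongr
          linarith
        have e2 : dist (x (i + 1)) (x (i + 1) * F (i + 1) (K * t - (i + 1 : ℕ))) ≤
            2 * K * (2 ^ m / 2 ^ j + 1) * R := by
          conv_lhs => rw [← mul_one (x (i + 1)), mul_one, ← mul_one (x (i + 1)), mul_assoc, one_mul]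
          rw [hinv]
          push_cast
          refine hFa (i + 1) j _ (by linarith) (by linarith) (lt_of_le_of_lt ?_ h1)
          gcongr
          linarith
        linarith [dist_triangle (x i * F i (K * s - i)) (x (i + 1))
          (x (i + 1) * F (i + 1) (K * t - (i + 1 : ℕ)))]

theorem HasChains.exists_coarse_path (hK0 : 0 < K) (hR : 0 < R) {r : ℝ} (hr : R ≤ r) {x y : Γ}
    (hxy : dist x y ≤ r) :
    ∃ f : ℝ → Γ, f 0 = x ∧ f 1 = y ∧ (∀ t, 0 ≤ t → t ≤ 1 → dist (f t) x ≤ 12 * K * r) ∧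
      ∀ (j : ℕ) (s t : ℝ), 0 ≤ s → s ≤ t → t ≤ 1 → K ^ j * (t - s) < 1 →
        dist (f s) (f t) ≤ 8 * K * r / 2 ^ j + 4 * K * R := by
  obtain ⟨m, hm1, hm2⟩ := exists_nat_pow_near ((one_le_div hR).2 hr) (one_lt_two (α := ℝ))
  rw [le_div_iff₀ hR] at hm1
  rw [div_lt_iff₀ hR] at hm2
  have hm3 : 2 ^ (m + 1) * R ≤ 2 * r := by rw [pow_succ]; linarith
  obtain ⟨f, f0, f1, -, -, hf⟩ := hK.exists_coarse_path_aux hinv hK0 hR (m + 1) (x⁻¹ * y)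
    ((dist_one_inv_mul hinv x y).trans_le (hxy.trans hm2.le))
  have hbound : ∀ (j : ℕ) (s t : ℝ), 0 ≤ s → s ≤ t → t ≤ 1 → K ^ j * (t - s) < 1 →
      dist (f s) (f t) ≤ 8 * K * r / 2 ^ j + 4 * K * R := by
    intro j s t hs hst ht h
    refine (hf j s t hs hst ht h).trans ?_
    have : 4 * K * (2 ^ (m + 1) / 2 ^ j + 1) * R =
        4 * K * (2 ^ (m + 1) * R) / 2 ^ j + 4 * K * R := by ring
    rw [this]
    gcongr ?_ / _ + _
    calc 4 * K * (2 ^ (m + 1) * R) ≤ 4 * K * (2 * r) := by gcongr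
      _ = _ := by ring
  have hK1 : (1 : ℝ) ≤ K := by exact_mod_cast hK0
  have hr0 : 0 ≤ r := hR.le.trans hr
  refine ⟨fun t => x * f t, by simp [f0], by simp [f1], fun t ht0 ht1 => ?_,
    fun j s t hs hst ht h => by rw [hinv]; exact hbound j s t hs hst ht h⟩
  rcases ht1.eq_or_lt with rfl | ht1
  · beta_reduce
    rw [f1, mul_inv_cancel_left, dist_comm]
    nlinarith
  · have := hbound 0 0 t le_rfl ht0 ht1.le (by simpa)
    rw [f0, ← hinv x, mul_one, pow_zero, div_one, dist_comm] at this
    have h2 : 4 * K * R ≤ 4 * K * r := by gcongr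
    linarith

/-- The ultralimit of discontinuous coarse paths is continuous: the additive error `4 * K * R`
vanishes after division by `d n`, leaving a modulus `8 * K * δ / 2 ^ j` at time scale `K ^ (-j)`. -/
theorem HasChains.exists_path (hK0 : 0 < K) (hR : 0 < R) {ω : Ultrafilter ℕ}
    (hω : (ω : Filter ℕ) ≤ atTop) {d : ScalingSequence} {e : ℕ → Γ} {x y : ConeSequence ω d e}
    {δ : ℝ} (hδ : 0 < δ) (hxy : dist x y < δ) :
    ∃ p : Path (SeparationQuotient.mk x) (SeparationQuotient.mk y),
      ∀ t, dist (p t) (SeparationQuotient.mk x) ≤ 12 * K * δ := by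
  have hd : Tendsto d.toFun ω atTop := d.tendsto_atTop.mono_left hω
  have key : ∀ n, ∃ f : ℝ → Γ,
      (dist (x.toFun n) (y.toFun n) ≤ δ * d.toFun n ∧ R ≤ δ * d.toFun n →
        f 0 = x.toFun n ∧ f 1 = y.toFun n) ∧
      (∀ t, 0 ≤ t → t ≤ 1 → dist (f t) (x.toFun n) ≤ 12 * K * (δ * d.toFun n)) ∧
      ∀ (j : ℕ) (s t : ℝ), 0 ≤ s → s ≤ t → t ≤ 1 → K ^ j * (t - s) < 1 →
        dist (f s) (f t) ≤ 8 * K * (δ * d.toFun n) / 2 ^ j + 4 * K * R := by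
    intro n
    by_cases h : dist (x.toFun n) (y.toFun n) ≤ δ * d.toFun n ∧ R ≤ δ * d.toFun n
    · obtain ⟨f, f0, f1, hf⟩ := hK.exists_coarse_path hinv hK0 hR h.2 h.1
      exact ⟨f, fun _ => ⟨f0, f1⟩, hf⟩
    -- For the `ω`-negligible set of bad indices a constant path keeps the bounds valid for every
    -- `n`.
    · have := d.pos n
      refine ⟨fun _ => x.toFun n, fun h' => absurd h' h, fun t _ _ => ?_, fun j s t _ _ _ _ => ?_⟩
      · rw [dist_self]; positivity
      · rw [dist_self]; positivity
  choose f hf01 hfx hf using key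
  have hends : ∀ᶠ n in (ω : Filter ℕ), f n 0 = x.toFun n ∧ f n 1 = y.toFun n := by
    filter_upwards [ConeSequence.eventually_dist_lt hxy, hd.eventually_ge_atTop (R / δ)] with n h1 h2
    exact hf01 n ⟨h1.le, by rwa [div_le_iff₀' hδ] at h2⟩
  let F : unitInterval → ConeSequence ω d e := fun t => ⟨fun n => f n t, by
    obtain ⟨C, hC⟩ := x.bounded
    refine ⟨12 * K * δ + C, fun n => ?_⟩
    have h1 := hC n
    have h2 := hfx n t t.2.1 t.2.2
    rw [div_le_iff₀ (d.pos n)] at h1 ⊢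
    linarith [dist_triangle (f n t) (x.toFun n) (e n)]⟩
  have hF0 : SeparationQuotient.mk (F 0) = SeparationQuotient.mk x := by
    rw [SeparationQuotient.mk_eq_mk, Metric.inseparable_iff]
    refine le_antisymm (ConeSequence.dist_le_of_eventually ?_) dist_nonneg
    filter_upwards [hends] with n hn
    simp [F, hn.1]
  have hF1 : SeparationQuotient.mk (F 1) = SeparationQuotient.mk y := by
    rw [SeparationQuotient.mk_eq_mk, Metric.inseparable_iff]
    refine le_antisymm (ConeSequence.dist_le_of_eventually ?_) dist_nonneg
    filter_upwards [hends] with n hn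
    simp [F, hn.2]
  have hF : Continuous F := by
    rw [Metric.continuous_iff]
    intro b ε hε
    obtain ⟨j, hj⟩ := pow_unbounded_of_one_lt (8 * K * δ / (ε / 4)) (one_lt_two (α := ℝ))
    have hKj : (0 : ℝ) < K ^ j := by positivity
    have hle : ∀ s t : unitInterval, s ≤ t → (K : ℝ) ^ j * (t - s) < 1 →
        dist (F s) (F t) < ε := by
      intro s t hst h
      refine lt_of_le_of_lt (ConeSequence.dist_le_of_eventually (c := ε / 2) ?_) (by linarith)
      filter_upwards [hd.eventually_ge_atTop (4 * K * R / (ε / 4))] with n hn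
      refine (hf n j s t s.2.1 hst t.2.2 h).trans ?_
      rw [div_le_iff₀ (by positivity)] at hn
      rw [div_lt_iff₀ (by positivity)] at hj
      have h3 : 8 * K * (δ * d.toFun n) / 2 ^ j ≤ d.toFun n * (ε / 4) := by
        rw [div_le_iff₀ (by positivity)]
        nlinarith [d.pos n]
      linarith
    refine ⟨1 / K ^ j, by positivity, fun a hab => ?_⟩
    rw [lt_div_iff₀' hKj, Subtype.dist_eq, Real.dist_eq] at hab
    rcases le_total a b with h | h
    · refine hle a b h (lt_of_eq_of_lt ?_ hab)
      rw [abs_sub_comm, abs_of_nonneg (sub_nonneg.2 (Subtype.coe_le_coe.2 h))]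
    · rw [dist_comm]
      refine hle b a h (lt_of_eq_of_lt ?_ hab)
      rw [abs_of_nonneg (sub_nonneg.2 (Subtype.coe_le_coe.2 h))]
  refine ⟨⟨⟨fun t => SeparationQuotient.mk (F t), SeparationQuotient.continuous_mk.comp hF⟩,
    hF0, hF1⟩, fun t => ?_⟩
  change dist (SeparationQuotient.mk (F t)) _ ≤ _
  rw [SeparationQuotient.dist_mk]
  refine ConeSequence.dist_le_of_eventually (Eventually.of_forall fun n => ?_)
  exact (hfx n t t.2.1 t.2.2).trans_eq (by ring)

end CoarsePaths

/-! ### Holonomy of paths in the cone. -/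

section Holonomy

variable {Γ : Type*} [Group Γ] [MetricSpace Γ] {H : ℕ → Type*} [∀ n, Group (H n)]
  {ω : Ultrafilter ℕ} {d : ScalingSequence} {e : ℕ → Γ}

/-- The sequence `h` is the holonomy of the path `p` from the class of `x` to the class of `y`,
with respect to the maps `φ n`: along all fine dyadic subdivisions of `p` and all lifts of the
subdivision points to sequences in `Γ`, the product of the increments under `φ n` is `h n` for
`ω`-almost all `n`, up to the correction for the choice of the endpoints. -/
def HasHolonomy (φ : ∀ n, Γ → H n) {X Y : AsymptoticCone ω d e} (p : Path X Y)
    (x y : ℕ → Γ) (h : ∀ n, H n) : Prop :=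
  ∃ k₀, ∀ k ≥ k₀, ∀ w : ℕ → ConeSequence ω d e,
    (∀ i ≤ 2 ^ k, SeparationQuotient.mk (w i) = p.extend (i / 2 ^ k)) →
    ∀ᶠ n in (ω : Filter ℕ), chainProd (φ n) (fun i => (w i).toFun n) (2 ^ k) =
      φ n (((w 0).toFun n)⁻¹ * x n) * h n * φ n ((y n)⁻¹ * (w (2 ^ k)).toFun n)

variable {φ : ∀ n, Γ → H n} (hinv : ∀ g x y : Γ, dist (g * x) (g * y) = dist x y)
  (hφ : ∀ n, IsMulHomOnBall (d.toFun n) (φ n))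

include hinv hφ

/-- Points of a path of radius below `1 / 2` are pairwise at distance below `1`, so lifted samples
lie within `d n` of each other and the product telescopes. -/
theorem hasHolonomy_of_forall_dist_le {x y : ConeSequence ω d e}
    (p : Path (SeparationQuotient.mk x) (SeparationQuotient.mk y)) {c : ℝ} (hc : c < 1 / 2)
    (hp : ∀ t, dist (p t) (SeparationQuotient.mk x) ≤ c) :
    HasHolonomy φ p x.toFun y.toFun fun n => φ n ((x.toFun n)⁻¹ * y.toFun n) := by
  refine ⟨0, fun k _ w hw => ?_⟩
  have hw' : ∀ i ≤ 2 ^ k, dist (w i) x ≤ c := fun i hi => by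
    rw [← SeparationQuotient.dist_mk, hw i hi]
    exact hp _
  have hyx : dist y x ≤ c := by
    rw [← SeparationQuotient.dist_mk]
    simpa using hp 1
  have hww : ∀ᶠ n in (ω : Filter ℕ), ∀ i ∈ Set.Iic (2 ^ k), ∀ j ∈ Set.Iic (2 ^ k),
      dist ((w i).toFun n) ((w j).toFun n) ≤ d.toFun n := by
    rw [eventually_all_finite (Set.finite_Iic _)]
    intro i hi
    rw [eventually_all_finite (Set.finite_Iic _)]
    intro j hj
    refine ConeSequence.eventually_dist_le ?_
    linarith [dist_triangle_right (w i) (w j) x, hw' i hi, hw' j hj]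
  have h0x := ConeSequence.eventually_dist_le (x := w 0) (y := x)
    (by linarith [hw' 0 (Nat.zero_le _)])
  have hxy := ConeSequence.eventually_dist_le (x := x) (y := y) (by rw [dist_comm]; linarith)
  have h0y := ConeSequence.eventually_dist_le (x := w 0) (y := y)
    (by linarith [hw' 0 (Nat.zero_le _), dist_triangle_right (w 0) y x])
  have hyN := ConeSequence.eventually_dist_le (x := y) (y := w (2 ^ k))
    (by linarith [hw' _ le_rfl, dist_triangle_right y (w (2 ^ k)) x])
  filter_upwards [hww, h0x, hxy, h0y, hyN] with n hww h0x hxy h0y hyN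
  rw [(hφ n).chainProd_eq hinv (d.pos n).le hww, (hφ n).map_triangle hinv h0x hxy h0y,
    (hφ n).map_triangle hinv h0y hyN (hww 0 (Nat.zero_le _) _ (Set.mem_Iic.2 le_rfl))]

/-- Level `k + 1` of the dyadic subdivision restricts to level `k` on each half, and the two
corrections at the midpoint cancel. -/
theorem HasHolonomy.trans {X Y Z : AsymptoticCone ω d e} {p : Path X Y} {q : Path Y Z}
    {x y z : ℕ → Γ} {g h : ∀ n, H n} (hp : HasHolonomy φ p x y g) (hq : HasHolonomy φ q y z h)
    (hy : ∃ y' : ConeSequence ω d e, SeparationQuotient.mk y' = Y ∧ y'.toFun = y) :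
    HasHolonomy φ (p.trans q) x z fun n => g n * h n := by
  obtain ⟨k₁, hp⟩ := hp
  obtain ⟨k₂, hq⟩ := hq
  obtain ⟨y, rfl, rfl⟩ := hy
  refine ⟨max k₁ k₂ + 1, fun k' hk w hw => ?_⟩
  obtain ⟨k, rfl⟩ : ∃ k, k' = k + 1 := ⟨k' - 1, by lia⟩
  have hk1 : k ≥ k₁ := by lia
  have hk2 : k ≥ k₂ := by lia
  have h2 : 2 ^ (k + 1) = 2 ^ k + 2 ^ k := by ring
  have hpow : (0 : ℝ) < 2 ^ k := by positivity
  have h1 : ∀ i ≤ 2 ^ k, SeparationQuotient.mk (w i) = p.extend (i / 2 ^ k) := fun i hi => by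
    have hi' : (i : ℝ) ≤ 2 ^ k := by exact_mod_cast hi
    have hle : (i : ℝ) / 2 ^ (k + 1) ≤ 1 / 2 := by
      rw [pow_succ, div_le_div_iff₀ (by positivity) two_pos]
      linarith
    rw [hw i (by lia), Path.extend_apply _ ⟨by positivity, by linarith⟩, Path.trans_apply,
      dif_pos hle, Path.extend_apply _ ⟨by positivity, (div_le_one hpow).2 hi'⟩]
    congr 2
    change 2 * ((i : ℝ) / 2 ^ (k + 1)) = i / 2 ^ k
    rw [pow_succ]
    field_simp
  have h3 : ∀ i ≤ 2 ^ k, SeparationQuotient.mk (w (2 ^ k + i)) = q.extend (i / 2 ^ k) := by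
    intro i hi
    -- The midpoint falls under the first branch of `Path.trans`.
    rcases Nat.eq_zero_or_pos i with rfl | hi0
    · rw [add_zero, h1 _ le_rfl]
      simp
    have hi' : (i : ℝ) ≤ 2 ^ k := by exact_mod_cast hi
    have hi0' : (0 : ℝ) < i := by exact_mod_cast hi0
    have hlt : ¬ ((2 ^ k + i : ℕ) : ℝ) / 2 ^ (k + 1) ≤ 1 / 2 := by
      rw [pow_succ, div_le_div_iff₀ (by positivity) two_pos]
      push_cast
      linarith
    have hle1 : ((2 ^ k + i : ℕ) : ℝ) / 2 ^ (k + 1) ≤ 1 := by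
      rw [pow_succ, div_le_one (by positivity)]
      push_cast
      linarith
    rw [hw _ (by lia), Path.extend_apply _ ⟨by positivity, hle1⟩, Path.trans_apply,
      dif_neg hlt, Path.extend_apply _ ⟨by positivity, (div_le_one hpow).2 hi'⟩]
    congr 2
    change 2 * (((2 ^ k + i : ℕ) : ℝ) / 2 ^ (k + 1)) - 1 = i / 2 ^ k
    rw [pow_succ]
    push_cast
    field_simp
    ring
  have hmid : SeparationQuotient.mk (w (2 ^ k)) = SeparationQuotient.mk y := by
    rw [h1 _ le_rfl]
    simp
  filter_upwards [hp k hk1 w h1, hq k hk2 (fun i => w (2 ^ k + i)) h3,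
    ConeSequence.eventually_dist_le_of_mk_eq hmid] with n hpn hqn hn
  rw [h2, chainProd_add, hpn, hqn, add_zero]
  have := (hφ n).map_inv_mul_mul_map hinv (d.pos n).le (dist_comm _ (y.toFun n) ▸ hn)
  simp only [mul_assoc]
  rw [← mul_assoc (φ n ((y.toFun n)⁻¹ * _)), this, one_mul]

/-- Sample the homotopy on a fine dyadic grid. For `ω`-almost all `n`, neighbouring lifts are within
`d n`, so `chainProd_grid` applies; the vertical sides are constant in the cone and contribute only
endpoint corrections. -/
theorem HasHolonomy.of_homotopic {x y : ConeSequence ω d e}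
    {p q : Path (SeparationQuotient.mk x) (SeparationQuotient.mk y)}
    {h : ∀ n, H n} (hp : HasHolonomy φ p x.toFun y.toFun h) (hpq : p.Homotopic q) :
    HasHolonomy φ q x.toFun y.toFun h := by
  obtain ⟨F⟩ := hpq
  obtain ⟨δ, hδ, hF⟩ := Metric.uniformContinuous_iff.1
    (CompactSpace.uniformContinuous_of_continuous F.continuous) 1 one_pos
  obtain ⟨k₁, hk₁⟩ := exists_pow_lt_of_lt_one hδ (one_half_lt_one (α := ℝ))
  obtain ⟨k₀, hp⟩ := hp
  refine ⟨max k₀ k₁, fun k hk w hw => ?_⟩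
  have hkδ : (1 / 2 : ℝ) ^ k < δ :=
    (pow_le_pow_of_le_one (by norm_num) (by norm_num) (by lia)).trans_lt hk₁
  have hpow : (0 : ℝ) < 2 ^ k := by positivity
  choose l hl using SeparationQuotient.surjective_mk (X := ConeSequence ω d e)
  let P : ℕ → unitInterval := fun i => Set.projIcc 0 1 zero_le_one (i / 2 ^ k : ℝ)
  have hP : ∀ i, dist (P i) (P (i + 1)) < δ := fun i => by
    refine lt_of_le_of_lt (Set.abs_projIcc_sub_projIcc zero_le_one) (lt_of_eq_of_lt ?_ hkδ)
    rw [← sub_div, Nat.cast_succ, sub_add_cancel_left, abs_div, abs_neg, abs_one, abs_of_pos hpow,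
      one_div_pow]
  have hP0 : P 0 = 0 := by simp [P]
  have hP1 : P (2 ^ k) = 1 := by simp [P]
  -- The last row is the prescribed lift `w` of `q`; the other rows may be lifted arbitrarily.
  let u : ℕ → ℕ → ConeSequence ω d e := fun i j =>
    if i = 2 ^ k then w j else l (F (P i, P j))
  have hu : ∀ i ≤ 2 ^ k, ∀ j ≤ 2 ^ k, SeparationQuotient.mk (u i j) = F (P i, P j) := by
    intro i _ j hj
    simp only [u]
    split_ifs with hi
    · rw [hw j hj, hi, hP1, F.apply_one]
      rfl
    · exact hl _
  have hclose : ∀ i j i' j', i ≤ 2 ^ k → j ≤ 2 ^ k → i' ≤ 2 ^ k → j' ≤ 2 ^ k →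
      (i' = i ∨ i' = i + 1) → (j' = j ∨ j' = j + 1) →
      ∀ᶠ n in (ω : Filter ℕ), dist ((u i j).toFun n) ((u i' j').toFun n) ≤ d.toFun n := by
    intro i j i' j' hi hj hi' hj' hii hjj
    refine ConeSequence.eventually_dist_le ?_
    rw [← SeparationQuotient.dist_mk, hu i hi j hj, hu i' hi' j' hj']
    refine hF (max_lt ?_ ?_)
    · rcases hii with rfl | rfl
      · simpa using hδ
      · exact hP i
    · rcases hjj with rfl | rfl
      · simpa using hδ
      · exact hP j
  have hall : ∀ᶠ n in (ω : Filter ℕ), ∀ i ∈ Set.Iic (2 ^ k), ∀ j ∈ Set.Iic (2 ^ k),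
      ∀ i' ∈ Set.Iic (2 ^ k), ∀ j' ∈ Set.Iic (2 ^ k),
      (i' = i ∨ i' = i + 1) → (j' = j ∨ j' = j + 1) →
      dist ((u i j).toFun n) ((u i' j').toFun n) ≤ d.toFun n := by
    simp only [eventually_all_finite (Set.finite_Iic _), eventually_imp_distrib_left]
    exact fun i hi j hj i' hi' j' hj' hii hjj => hclose i j i' j' hi hj hi' hj' hii hjj
  have hleft : ∀ i ≤ 2 ^ k, SeparationQuotient.mk (u i 0) = SeparationQuotient.mk x := by
    intro i hi
    rw [hu i hi 0 (Nat.zero_le _), hP0]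
    simp
  have hright : ∀ i ≤ 2 ^ k, SeparationQuotient.mk (u i (2 ^ k)) = SeparationQuotient.mk y := by
    intro i hi
    rw [hu i hi _ le_rfl, hP1]
    simp
  have hconst : ∀ (j : ℕ) (z : ConeSequence ω d e),
      (∀ i ≤ 2 ^ k, SeparationQuotient.mk (u i j) = SeparationQuotient.mk z) →
      ∀ᶠ n in (ω : Filter ℕ),
        (∀ i ∈ Set.Iic (2 ^ k), ∀ i' ∈ Set.Iic (2 ^ k),
          dist ((u i j).toFun n) ((u i' j).toFun n) ≤ d.toFun n) ∧
        (∀ i ∈ Set.Iic (2 ^ k), dist ((u i j).toFun n) (z.toFun n) ≤ d.toFun n) := by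
    intro j z hz
    simp only [eventually_and, eventually_all_finite (Set.finite_Iic _)]
    refine ⟨fun i hi i' hi' => ?_, fun i hi => ?_⟩
    · exact ConeSequence.eventually_dist_le_of_mk_eq ((hz i hi).trans (hz i' hi').symm)
    · exact ConeSequence.eventually_dist_le_of_mk_eq (hz i hi)
  have hlow : ∀ i ≤ 2 ^ k, SeparationQuotient.mk (u 0 i) = p.extend (i / 2 ^ k) := fun i hi => by
    rw [hu 0 (Nat.zero_le _) i hi, hP0, F.apply_zero]
    rfl
  filter_upwards [hp k (by lia) (u 0) hlow, hall, hconst 0 x hleft, hconst (2 ^ k) y hright]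
    with n hpn hall hl hr
  have hN : 2 ^ k ∈ Set.Iic (2 ^ k) := Set.mem_Iic.2 le_rfl
  have h0 : 0 ∈ Set.Iic (2 ^ k) := Nat.zero_le _
  have hgrid := (hφ n).chainProd_grid hinv (w := fun i j => (u i j).toFun n) (m := 2 ^ k)
    (n := 2 ^ k) (fun i hi j hj => hall i hi j hj.le i hi (j + 1) hj (by simp) (by simp))
    (fun i hi j hj => hall i hi.le j hj (i + 1) hi j hj (by simp) (by simp))
    (fun i hi j hj => hall i hi.le j hj.le (i + 1) hi (j + 1) hj (by simp) (by simp))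
  have hd0 := (d.pos n).le
  rw [hpn, (hφ n).chainProd_eq hinv hd0 hl.1, (hφ n).chainProd_eq hinv hd0 hr.1] at hgrid
  have huw : u (2 ^ k) = w := by simp [u]
  simp only [huw] at hgrid hl hr ⊢
  have e1 := (hφ n).map_triangle hinv (x := (u 0 0).toFun n) (y := (w 0).toFun n) (z := x.toFun n)
    (by simpa [huw] using hl.1 0 h0 _ hN) (by simpa [huw] using hl.2 _ hN) (hl.2 0 h0)
  have e2 := (hφ n).map_triangle hinv (x := y.toFun n) (y := (u 0 (2 ^ k)).toFun n)
    (z := (w (2 ^ k)).toFun n) (by rw [dist_comm]; exact hr.2 0 h0)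
    (by simpa [huw] using hr.1 0 h0 _ hN) (by rw [dist_comm]; simpa [huw] using hr.2 _ hN)
  rw [mul_assoc, e2, ← e1, mul_assoc, mul_assoc] at hgrid
  rw [← mul_left_cancel hgrid, mul_assoc]

omit hinv hφ in
theorem HasHolonomy.eventually_eq {x y : ConeSequence ω d e}
    {p : Path (SeparationQuotient.mk x) (SeparationQuotient.mk y)} {g h : ∀ n, H n}
    (hg : HasHolonomy φ p x.toFun y.toFun g) (hh : HasHolonomy φ p x.toFun y.toFun h) :
    ∀ᶠ n in (ω : Filter ℕ), g n = h n := by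
  obtain ⟨k₁, hg⟩ := hg
  obtain ⟨k₂, hh⟩ := hh
  choose l hl using SeparationQuotient.surjective_mk (X := ConeSequence ω d e)
  set k := max k₁ k₂
  filter_upwards [hg k (by lia) (fun i => l (p.extend (i / 2 ^ k))) fun i _ => hl _,
    hh k (by lia) (fun i => l (p.extend (i / 2 ^ k))) fun i _ => hl _] with n h1 h2
  simpa using h1.symm.trans h2

end Holonomy

/-- The kernel of `π` is normally generated by the finitely many elements identifying each generator
with its image under `σ ∘ π`: modulo these, `σ ∘ π` is the identity, yet it kills the kernel. -/
theorem Group.isFinitelyPresented_of_retract {G H : Type*} [Group G] [Group H]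
    [hH : Group.IsFinitelyPresented H] (π : H →* G) (σ : G →* H)
    (hπσ : ∀ g, π (σ g) = g) : Group.IsFinitelyPresented G := by
  refine Group.IsFinitelyPresented.of_surjective π (fun g => ⟨σ g, hπσ g⟩) ?_
  obtain ⟨n, ψ, hψ, -⟩ := hH.out
  let s : Fin n → H := fun i => ψ (FreeGroup.of i)
  let N : Subgroup H := Subgroup.normalClosure (Set.range fun i => (s i)⁻¹ * σ (π (s i)))
  refine ⟨_, Set.finite_range fun i => (s i)⁻¹ * σ (π (s i)), le_antisymm ?_ fun h hh => ?_⟩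
  · refine Subgroup.normalClosure_le_normal ?_
    rintro _ ⟨i, rfl⟩
    simp [MonoidHom.mem_ker, hπσ]
  · have key : (QuotientGroup.mk' N).comp ψ = (QuotientGroup.mk' N).comp ((σ.comp π).comp ψ) := by
      ext i
      exact QuotientGroup.eq.2 (Subgroup.subset_normalClosure ⟨i, rfl⟩)
    obtain ⟨f, rfl⟩ := hψ h
    have := DFunLike.congr_fun key f
    simp only [MonoidHom.comp_apply, MonoidHom.mem_ker.1 hh, map_one] at this
    exact (QuotientGroup.eq_one_iff _).1 this

/-! ### Extension of local homomorphisms and finite presentation. -/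

section FinitePresentation

universe u

variable {Γ : Type u} [Group Γ] [MetricSpace Γ]
  (hinv : ∀ g x y : Γ, dist (g * x) (g * y) = dist x y)

include hinv

/-- Counterexamples at diverging scales converge to a closed chain in a cone. Filled in with small
paths it is a loop whose holonomy is the nontrivial product, although the loop is null-homotopic.
The target groups may vary with `n`. -/
theorem exists_forall_chainProd_eq_one {K : ℕ} {R : ℝ} (hK : HasChains Γ K R) (hK0 : 0 < K)
    (hR : 0 < R)
    (hsc : ∀ ω : Ultrafilter ℕ, (ω : Filter ℕ) ≤ cofinite →
      ∀ (d : ScalingSequence) (e : ℕ → Γ), SimplyConnectedSpace (AsymptoticCone ω d e))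
    {η : ℝ} (hη : 0 < η) (hKη : 72 * K * η ≤ 1) (M : ℕ) :
    ∃ R' : ℝ, ∀ r ≥ R', ∀ (H : Type u) [Group H] (φ : Γ → H), IsMulHomOnBall r φ →
      ∀ y : ℕ → Γ, y 0 = 1 → y M = 1 → (∀ i, dist (y i) (y (i + 1)) ≤ η * r) →
        chainProd φ y M = 1 := by
  by_contra! h
  choose r hr H inst φ hφ y y0 yM hy hne using fun n : ℕ => h (n + 1)
  let d : ScalingSequence := ⟨r, fun n => lt_of_lt_of_le (by positivity) (hr n),
    tendsto_atTop_mono (fun n => (le_add_of_nonneg_right zero_le_one).trans (hr n))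
      tendsto_natCast_atTop_atTop⟩
  let ω : Ultrafilter ℕ := hyperfilter ℕ
  let e : ℕ → Γ := fun _ => 1
  have := hsc ω hyperfilter_le_cofinite d e
  have hφ' : ∀ n, IsMulHomOnBall (d.toFun n) (φ n) := hφ
  obtain ⟨Y, hY⟩ : ∃ Y : ℕ → ConeSequence ω d e, ∀ i n, (Y i).toFun n = y n i := by
    refine ⟨fun i => ⟨fun n => y n i, i * η, fun n => ?_⟩, fun _ _ => rfl⟩
    have := dist_le_of_dist_succ_le (hy n) i.zero_le
    rw [div_le_iff₀ (d.pos n), dist_comm]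
    rw [y0] at this
    refine this.trans_eq ?_
    simp [d, mul_assoc]
  have hsteps : ∀ i, dist (Y i) (Y (i + 1)) ≤ η := fun i => by
    refine ConeSequence.dist_le_of_eventually (Eventually.of_forall fun n => ?_)
    rw [hY, hY]
    exact hy n i
  have hrefl : HasHolonomy φ (Path.refl (SeparationQuotient.mk (Y 0))) (Y 0).toFun (Y 0).toFun
      fun n => 1 := by
    convert! hasHolonomy_of_forall_dist_le hinv hφ' (Path.refl (SeparationQuotient.mk (Y 0)))
      (c := 0) (by norm_num) (by simp) using 2 with n
    rw [inv_mul_cancel, (hφ' n).map_one (d.pos n).le]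
  have hpath : ∀ i, ∃ p : Path (SeparationQuotient.mk (Y 0)) (SeparationQuotient.mk (Y i)),
      HasHolonomy φ p (Y 0).toFun (Y i).toFun fun n => chainProd (φ n) (y n) i := by
    intro i
    induction i with
    | zero => exact ⟨_, hrefl⟩
    | succ i ih =>
      obtain ⟨p, hp⟩ := ih
      -- With `δ = 2 * η` the path has radius at most `24 * K * η ≤ 1 / 3`, below the threshold `1 /
      -- 2` for small paths.
      obtain ⟨q, hq⟩ := hK.exists_path hinv hK0 hR (ω := ω) Nat.hyperfilter_le_atTop
        (δ := 2 * η) (by positivity) (lt_of_le_of_lt (hsteps i) (by linarith))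
      refine ⟨p.trans q, ?_⟩
      convert! hp.trans hinv hφ' (hasHolonomy_of_forall_dist_le hinv hφ' q (by linarith) hq)
        ⟨Y i, rfl, rfl⟩ using 2 with n
      rw [chainProd, hY, hY]
  have hYM : Y M = Y 0 := by
    have h1 : (Y M).toFun = (Y 0).toFun := by
      ext n
      rw [hY, hY, y0, yM]
    cases hM : Y M
    cases h0 : Y 0
    simp_all
  have hloop := hpath M
  rw [hYM] at hloop
  obtain ⟨p, hp⟩ := hloop
  obtain ⟨n, hn⟩ := ((hp.of_homotopic hinv hφ'
    (SimplyConnectedSpace.paths_homotopic p (Path.refl _))).eventually_eq hrefl).exists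
  exact hne n hn

/-- Multiplicative maps on the ball of radius `r` extend, after restriction to the ball of radius
`η * r`, to the ball of radius `2 * r`, as soon as `r ≥ R`. -/
def HasExtensions (Γ : Type u) [Group Γ] [MetricSpace Γ] (η R : ℝ) : Prop :=
  ∀ r ≥ R, ∀ (H : Type u) [Group H] (φ : Γ → H), IsMulHomOnBall r φ →
    ∃ ψ : Γ → H, IsMulHomOnBall (2 * r) ψ ∧ ∀ a, dist 1 a ≤ η * r → ψ a = φ a

/-- The extension multiplies `φ` along a chosen chain of steps at most `η * r`; triviality on loops
makes it multiplicative and compatible with `φ`. -/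
theorem exists_hasExtensions {K : ℕ} {R : ℝ} (hK : HasChains Γ K R) (hK0 : 0 < K)
    (hR : 0 < R)
    (hsc : ∀ ω : Ultrafilter ℕ, (ω : Filter ℕ) ≤ cofinite →
      ∀ (d : ScalingSequence) (e : ℕ → Γ), SimplyConnectedSpace (AsymptoticCone ω d e)) :
    ∃ η R' : ℝ, 0 < η ∧ η ≤ 1 ∧ HasExtensions Γ η R' := by
  obtain ⟨m, hm⟩ := pow_unbounded_of_one_lt (72 * K : ℝ) (one_lt_two (α := ℝ))
  obtain ⟨η, hη⟩ : ∃ η : ℝ, η = 1 / 2 ^ m := ⟨_, rfl⟩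
  have hη0 : 0 < η := by rw [hη]; positivity
  have hmη : 2 ^ m * η = 1 := by rw [hη]; field_simp
  have hKη : 72 * K * η ≤ 1 := by rw [← hmη]; gcongr
  have hη1 : η ≤ 1 := by
    rw [hη]
    exact div_le_one_of_le₀ (one_le_pow₀ one_le_two) (by positivity)
  -- Since `2 ^ m * η = 1`, going from `2 * r` to `η * r` takes `m + 1` halvings. Loops of `3 * N`
  -- steps test multiplicativity; those of `N + 1` steps, a chain closed by one step, test agreement
  -- with `φ`.
  set N := K ^ (m + 1)
  obtain ⟨R₁, h₁⟩ := exists_forall_chainProd_eq_one hinv hK hK0 hR hsc hη0 hKη (N + N + N)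
  obtain ⟨R₂, h₂⟩ := exists_forall_chainProd_eq_one hinv hK hK0 hR hsc hη0 hKη (N + 1)
  refine ⟨η, max (R / η) (max R₁ R₂), hη0, hη1, fun r hr H _ φ hφ => ?_⟩
  obtain ⟨hrR, hr₁, hr₂⟩ : R / η ≤ r ∧ R₁ ≤ r ∧ R₂ ≤ r := by simpa using hr
  rw [div_le_iff₀' hη0] at hrR
  have hηr : 0 < η * r := hR.trans_le hrR
  have hr0 : 0 < r := pos_of_mul_pos_right hηr hη0.le
  have hηr_le : η * r ≤ r := mul_le_of_le_one_left hr0.le hη1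
  have hex : ∀ a : Γ, ∃ x : ℕ → Γ, dist 1 a ≤ 2 * r →
      x 0 = 1 ∧ (∀ i ≥ N, x i = a) ∧ ∀ i, dist (x i) (x (i + 1)) ≤ η * r := fun a => by
    by_cases ha : dist 1 a ≤ 2 * r
    · obtain ⟨x, hx⟩ := hK.exists_pow_chain hinv hK0 hR (m + 1) (η * r) hrR a (ha.trans_eq (by
        rw [pow_succ, mul_comm _ (2 : ℝ), mul_assoc, ← mul_assoc (2 ^ m), hmη, one_mul]))
      exact ⟨x, fun _ => hx⟩
    · exact ⟨1, fun h => absurd h ha⟩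
  choose x hx using hex
  refine ⟨fun a => chainProd φ (x a) N, fun a b ha hb hab => ?_, fun a ha => ?_⟩
  · obtain ⟨a0, aN, hxa⟩ := hx a ha
    obtain ⟨b0, bN, hxb⟩ := hx b hb
    obtain ⟨ab0, abN, hxab⟩ := hx _ hab
    -- The triangle loop: the chain to `a`, the translated chain from `a` to `a * b`, then the chain
    -- to `a * b` backwards.
    let y : ℕ → Γ := fun i =>
      if i < N then x a i else if i < N + N then a * x b (i - N) else x (a * b) (N + N + N - i)
    have hy1 : ∀ i ≤ N, y i = x a i := fun i hi => by
      rcases hi.eq_or_lt with rfl | hi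
      · have : 0 < N := by positivity
        simp [y, this, b0, aN N le_rfl]
      · simp [y, hi]
    have hy2 : ∀ i ≤ N, y (N + i) = a * x b i := fun i hi => by
      rcases hi.eq_or_lt with rfl | hi
      · simp [y, bN N le_rfl, abN N le_rfl]
      · simp [y, hi]
    have hy3 : ∀ i, y (N + N + i) = x (a * b) (N - i) := fun i => by
      simp [y, add_assoc, Nat.add_sub_add_left]
    have hstep : ∀ i, dist (y i) (y (i + 1)) ≤ η * r := fun i => by
      rcases lt_or_ge i N with hi | hi
      · rw [hy1 i hi.le, hy1 (i + 1) hi]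
        exact hxa i
      obtain ⟨i, rfl⟩ := Nat.exists_eq_add_of_le hi
      rcases lt_or_ge i N with hi | hi
      · rw [hy2 i hi.le, add_assoc, hy2 (i + 1) hi, hinv]
        exact hxb i
      obtain ⟨i, rfl⟩ := Nat.exists_eq_add_of_le hi
      rw [← add_assoc, hy3, add_assoc, hy3]
      rcases lt_or_ge i N with hi | hi
      · rw [dist_comm, show N - i = N - (i + 1) + 1 by lia]
        exact hxab _
      · rw [Nat.sub_eq_zero_of_le hi, Nat.sub_eq_zero_of_le (hi.trans i.le_succ), dist_self]
        exact hηr.le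
    have hloop := h₁ r hr₁ H φ hφ y (by rw [hy1 0 (Nat.zero_le _), a0])
      (by rw [hy3, Nat.sub_self, ab0]) hstep
    rw [chainProd_add, chainProd_add, chainProd_congr hy1, chainProd_congr hy2,
      chainProd_congr fun i _ => hy3 i, chainProd_mul_left] at hloop
    have hrev := hφ.chainProd_mul_reverse hinv hr0.le (w := x (a * b)) (n := N)
      fun i _ => (hxab i).trans hηr_le
    exact mul_right_cancel (hrev.trans hloop.symm)
  · obtain ⟨a0, aN, hxa⟩ := hx a (by linarith)
    have hN : 0 < N := by positivity
    let y : ℕ → Γ := fun i => if i ≤ N then x a i else 1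
    have hy1 : ∀ i ≤ N, y i = x a i := fun i hi => by simp [y, hi]
    have hy2 : ∀ i > N, y i = 1 := fun i hi => by simp [y, hi]
    have hstep : ∀ i, dist (y i) (y (i + 1)) ≤ η * r := fun i => by
      rcases lt_trichotomy i N with hi | rfl | hi
      · rw [hy1 i hi.le, hy1 (i + 1) hi]
        exact hxa i
      · rw [hy1 N le_rfl, hy2 _ N.lt_succ_self, aN N le_rfl, dist_comm]
        exact ha
      · rw [hy2 i hi, hy2 (i + 1) (by lia), dist_self]
        exact hηr.le
    have hloop := h₂ r hr₂ H φ hφ y (by rw [hy1 0 (Nat.zero_le _), a0])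
      (hy2 _ N.lt_succ_self) hstep
    rw [chainProd, chainProd_congr hy1, hy1 N le_rfl, hy2 _ N.lt_succ_self, aN N le_rfl] at hloop
    have := hφ.map_inv_mul_mul_map hinv hr0.le (x := a) (y := 1) (by
      rw [dist_comm]; exact ha.trans hηr_le)
    rw [inv_one, one_mul] at this
    exact (eq_inv_of_mul_eq_one_left hloop).trans (eq_inv_of_mul_eq_one_right this).symm

omit hinv in
-- Successive extensions agree on balls of radius `η * 2 ^ k * r`, which exhaust `Γ`, so their
-- values stabilize at every point.
theorem HasExtensions.exists_monoidHom {η R : ℝ} (h : HasExtensions Γ η R) (hη : 0 < η)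
    {r : ℝ} (hr : R ≤ r) (hr0 : 0 < r) {H : Type u} [Group H] {φ : Γ → H}
    (hφ : IsMulHomOnBall r φ) :
    ∃ Φ : Γ →* H, ∀ a, dist 1 a ≤ η * r → Φ a = φ a := by
  have hstep : ∀ (k : ℕ) (f : {f : Γ → H // IsMulHomOnBall (2 ^ k * r) f}),
      ∃ f' : {f : Γ → H // IsMulHomOnBall (2 ^ (k + 1) * r) f},
        ∀ a, dist 1 a ≤ η * (2 ^ k * r) → f'.1 a = f.1 a := fun k f => by
    obtain ⟨ψ, h1, h2⟩ := h (2 ^ k * r)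
      (hr.trans (le_mul_of_one_le_left hr0.le (one_le_pow₀ one_le_two))) H f.1 f.2
    exact ⟨⟨ψ, by rwa [pow_succ, mul_comm _ (2 : ℝ), mul_assoc]⟩, h2⟩
  choose S hS using hstep
  let f : ∀ k : ℕ, {f : Γ → H // IsMulHomOnBall (2 ^ k * r) f} :=
    Nat.rec ⟨φ, by simpa using hφ⟩ S
  have hmono : ∀ {k l : ℕ}, k ≤ l → (2 : ℝ) ^ k * r ≤ 2 ^ l * r := fun {k l} hkl =>
    mul_le_mul_of_nonneg_right (pow_le_pow_right₀ one_le_two hkl) hr0.le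
  have hf : ∀ (k l : ℕ), k ≤ l → ∀ a, dist 1 a ≤ η * (2 ^ k * r) → (f l).1 a = (f k).1 a := by
    intro k l hkl a ha
    induction l, hkl using Nat.le_induction with
    | base => rfl
    | succ l hkl ih =>
      rw [← ih]
      exact hS l (f l) a (ha.trans (mul_le_mul_of_nonneg_left (hmono hkl) hη.le))
  have hlarge : ∀ a : Γ, ∃ k : ℕ, dist 1 a ≤ η * (2 ^ k * r) ∧ dist 1 a ≤ 2 ^ k * r := fun a => by
    obtain ⟨k, hk⟩ := pow_unbounded_of_one_lt (max (dist 1 a / (η * r)) (dist 1 a / r))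
      (one_lt_two (α := ℝ))
    obtain ⟨h1, h2⟩ := max_lt_iff.1 hk
    rw [div_lt_iff₀ (by positivity)] at h1 h2
    exact ⟨k, by linarith, h2.le⟩
  choose k hk1 hk2 using hlarge
  refine ⟨MonoidHom.mk' (fun a => (f (k a)).1 a) fun a b => ?_, fun a ha => ?_⟩
  · obtain ⟨l, ha, hb, hab⟩ : ∃ l, k a ≤ l ∧ k b ≤ l ∧ k (a * b) ≤ l :=
      ⟨max (k a) (max (k b) (k (a * b))), by simp⟩
    rw [← hf _ l ha a (hk1 a), ← hf _ l hb b (hk1 b), ← hf _ l hab _ (hk1 _)]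
    exact (f l).2 a b ((hk2 _).trans (hmono ha)) ((hk2 _).trans (hmono hb))
      ((hk2 _).trans (hmono hab))
  · exact hf 0 (k a) (Nat.zero_le _) a (by simpa using ha)

theorem HasExtensions.isFinitelyPresented {K : ℕ} {R : ℝ} (hK : HasChains Γ K R) (hR : 0 < R)
    (finite_balls : ∀ (x : Γ) (r : ℝ), (Metric.ball x r).Finite) {η R' : ℝ}
    (h : HasExtensions Γ η R') (hη : 0 < η) (hη1 : η ≤ 1) :
    Group.IsFinitelyPresented Γ := by
  obtain ⟨r, hr', hrR⟩ : ∃ r, R' ≤ r ∧ R / η ≤ r :=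
    ⟨max R' (R / η), le_max_left _ _, le_max_right _ _⟩
  have hr0 : 0 < r := lt_of_lt_of_le (by positivity) hrR
  rw [div_le_iff₀' hη] at hrR
  let S := {g : Γ // dist 1 g ≤ r}
  have : Finite S := ((finite_balls 1 (r + 1)).subset fun g hg => by
    rw [Metric.mem_ball, dist_comm]
    exact lt_of_le_of_lt hg (by linarith)).to_subtype
  -- The multiplication table of the ball; these relations say exactly that the tautological map is
  -- a local homomorphism.
  let rels : Set (FreeGroup S) := {w | ∃ a b c : S, (a : Γ) * b = c ∧
    w = FreeGroup.of c * (FreeGroup.of a * FreeGroup.of b)⁻¹}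
  have : Finite rels := ((Set.finite_range fun p : S × S × S =>
    FreeGroup.of p.2.2 * (FreeGroup.of p.1 * FreeGroup.of p.2.1)⁻¹).subset (by
      rintro _ ⟨a, b, c, -, rfl⟩
      exact ⟨(a, b, c), rfl⟩)).to_subtype
  let π : PresentedGroup rels →* Γ := PresentedGroup.toGroup (f := Subtype.val) (by
    rintro _ ⟨a, b, c, habc, rfl⟩
    simp [← habc])
  classical
  let φ : Γ → PresentedGroup rels := fun g => if hg : dist 1 g ≤ r then .of ⟨g, hg⟩ else 1
  have hφ : IsMulHomOnBall r φ := fun a b ha hb hab => by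
    simp only [φ, dif_pos ha, dif_pos hb, dif_pos hab]
    exact PresentedGroup.mk_eq_mk_of_mul_inv_mem ⟨⟨a, ha⟩, ⟨b, hb⟩, ⟨a * b, hab⟩, rfl, rfl⟩
  obtain ⟨Φ, hΦ⟩ := h.exists_monoidHom hη hr' hr0 hφ
  -- `Φ` is known to be tautological only on the ball of radius `η * r`; that ball generates `Γ`
  -- because `R ≤ η * r`.
  have hid : π.comp Φ = MonoidHom.id Γ := by
    refine MonoidHom.eq_of_eqOn_dense (hK.closure_eq_top hinv hR) fun g hg => ?_
    have hg' : dist 1 g ≤ η * r := le_trans hg hrR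
    have hgr : dist 1 g ≤ r := hg'.trans (mul_le_of_le_one_left hr0.le hη1)
    rw [MonoidHom.comp_apply, hΦ g hg']
    simp only [φ, dif_pos hgr]
    exact PresentedGroup.toGroup.of _
  exact Group.isFinitelyPresented_of_retract π Φ (DFunLike.congr_fun hid)

end FinitePresentation

theorem mainTheorem1 {Γ : Type*} [Group Γ] [MetricSpace Γ]
    (left_invariant : ∀ g x y : Γ, dist (g * x) (g * y) = dist x y)
    (finite_balls : ∀ (x : Γ) (r : ℝ), (Metric.ball x r).Finite) :
    ((∀ ω : Ultrafilter ℕ, (ω : Filter ℕ) ≤ cofinite →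
        ∀ (d : ScalingSequence) (e : ℕ → Γ), PathConnectedSpace (AsymptoticCone ω d e)) →
      Group.FG Γ) ∧
    ((∀ ω : Ultrafilter ℕ, (ω : Filter ℕ) ≤ cofinite →
        ∀ (d : ScalingSequence) (e : ℕ → Γ), SimplyConnectedSpace (AsymptoticCone ω d e)) →
      Group.IsFinitelyPresented Γ) := by
  refine ⟨fun hpc => ?_, fun hsc => ?_⟩
  · obtain ⟨K, -, R, hR, hK⟩ := exists_hasChains_of_pathConnected hpc
    refine Group.fg_iff.2 ⟨_, hK.closure_eq_top left_invariant hR,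
      (finite_balls 1 (R + 1)).subset fun g hg => ?_⟩
    rw [Metric.mem_ball, dist_comm]
    exact lt_of_le_of_lt hg (by linarith)
  · obtain ⟨K, hK0, R, hR, hK⟩ := exists_hasChains_of_pathConnected fun ω hω d e =>
      have := hsc ω hω d e
      inferInstance
    obtain ⟨η, R', hη, hη1, h⟩ := exists_hasExtensions left_invariant hK hK0 hR hsc
    exact h.isFinitelyPresented left_invariant hK hR finite_balls hη hη1
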